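/- Consider the synchronous parameterized push gossip on $n$ nodes $\{0,\dots,n-1\}$ with parameter $s\in(0,1]$ and source $k$. Initially only $k$ is active and informed. In each round, every node that is active at the start of the round sends one message to a node chosen uniformly at random among all $n$ nodes (itself included), and keeps its activity with probability $s$ (and loses it with probability $1-s$), all these choices being independent. After the round, the active nodes are exactly the nodes that received a message in this round and the senders that kept their activity, and every node that received a message is informed. Rounds are carried out indefinitely, also after all nodes have become informed. (a) For every $s\in(0,1]$, every $0<\delta<1$ and every $C\ge 1$ there is $N$ such that for all $n\ge N$ and every source $k$, with probability at least $1-\delta$, at least $C\,n\log n$ messages in total are sent during the first $\lfloor 6C\log(n)/s\rfloor$ rounds. (b) Consequently the spreading time is $O(\log(n)/s)$: there is a constant $K$ such that for every $s\in(0,1]$ and every $0<\delta<1$ there is $N$ such that for all $n\ge N$ and every source $k$, with probability at least $1-\delta$, all $n$ nodes are informed after $\lfloor K\log(n)/s\rfloor$ rounds. -/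

import Mathlib

/-!
Synchronous version of the parameterized push gossip on the complete graph with node set `Fin n`.
-/

namespace Gossip

noncomputable section

/-- The coin of a sender: `true` (the sender stays active) has probability `s`. -/
def keepCoin (s : unitInterval) : PMF Bool :=
  PMF.ofFintype (fun b => ENNReal.ofReal (if b then (s : ℝ) else 1 - (s : ℝ))) (by
    rw [Fintype.sum_bool, ← ENNReal.ofReal_add] <;> simp [s.2.1, s.2.2])

/-- The law of a family of independent random variables indexed by `V`, each with law `p`. -/
def iidFamily (V : Type) [Fintype V] [DecidableEq V] {β : Type} [Fintype β] (p : PMF β) :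
    PMF (V → β) :=
  PMF.ofFintype (fun f => ∏ v, p (f v)) (by
    have h := p.tsum_coe
    rw [tsum_fintype] at h
    rw [← Fintype.piFinset_univ, ← Finset.prod_univ_sum]
    simp [h])

/-- The random choice of one node in one round: the recipient of its message, uniform among all
`n` nodes (the sender included), and, independently, whether it stays active. -/
def nodeChoice (n : ℕ) [NeZero n] (s : unitInterval) : PMF (Fin n × Bool) :=
  (PMF.uniformOfFintype (Fin n)).bind fun j => (keepCoin s).map fun b => (j, b)

/-- A state of the protocol: the set `A` of active nodes, the set `I` of informed nodes, and the
number of messages sent so far. -/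
structure State (n : ℕ) where
  active : Finset (Fin n)
  informed : Finset (Fin n)
  sent : ℕ

/-- At the start only the source `k` is informed and active, and no message has been sent. -/
def initial {n : ℕ} (k : Fin n) : State n where
  active := {k}
  informed := {k}
  sent := 0

/-- One synchronous round, given the choices of all nodes (only those of the nodes that are active
at the start of the round matter). Every active node `i` sends one message, to `(c i).1`;
afterwards the active nodes are the recipients of these messages and the senders that stay active
by their coin. -/
def roundStep {n : ℕ} (c : Fin n → Fin n × Bool) (σ : State n) : State n where
  active := (σ.active.filter fun i => (c i).2 = true) ∪ σ.active.image fun i => (c i).1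
  informed := σ.informed ∪ σ.active.image fun i => (c i).1
  sent := σ.sent + σ.active.card

/-- The law of the state after `R` synchronous rounds with source `k`, the choices being
independent over nodes and rounds. The rounds continue also after all nodes are informed. -/
def run (n : ℕ) [NeZero n] (s : unitInterval) (k : Fin n) : ℕ → PMF (State n)
  | 0 => PMF.pure (initial k)
  | R + 1 => (run n s k R).bind fun σ =>
      (iidFamily (Fin n) (nodeChoice n s)).map fun c => roundStep c σ

/-- The probability of the event `E` under `p`. -/
def prob {α : Type} (p : PMF α) (E : Set α) : ℝ := (p.toOuterMeasure E).toReal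

end

end Gossip

/-! Two potentials carry the proof. With `A` the active set and `M` the number of messages sent,
`exp (-M / n) / |A|` contracts in mean by `1 - s / 2` each round. Indeed, if `Y` is the set of
recipients, convexity of `1 / x` bounds the mean of `1 / |A'|` over the coins by `(1 - s) / |Y| + s
/ |Y ∪ A|`. Without collisions this would be `(1 - s / 2) / |A|`; collisions cost at most `(1 + 1 /
n) ^ |A| ≤ exp (|A| / n)`, which the `|A|` new messages in `M` pay for. As `|A| ≤ n`, a small `M`
keeps the potential large, so Markov's inequality gives (a) (`toOuterMeasure_sent_lt_le`). For (b),
`exp (M / n)` on the event that `v` is uninformed is a supermartingale, so missing `v` despite `2 n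
log n` messages has probability at most `n⁻²`. A union bound over `v`, with (a) for `C = 2`,
concludes. -/

namespace Gossip

open Function

/-! ### Finite product weights and resampling. -/

section ProductWeights

variable {V β : Type} [Fintype V] [DecidableEq V]

theorem prod_update_mul (w : β → ℝ) (c : V → β) (i : V) (x : β) :
    (∏ v, w (update c i x v)) * w (c i) = (∏ v, w (c v)) * w x := by
  rw [← Finset.mul_prod_erase Finset.univ (fun v => w (update c i x v)) (Finset.mem_univ i),
    ← Finset.mul_prod_erase Finset.univ (fun v => w (c v)) (Finset.mem_univ i)]
  have h : ∏ v ∈ Finset.univ.erase i, w (update c i x v) = ∏ v ∈ Finset.univ.erase i, w (c v) :=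
    Finset.prod_congr rfl fun v hv => by rw [update_of_ne (Finset.ne_of_mem_erase hv)]
  rw [h, update_self]
  ring

variable [Fintype β]

/-- The expectation of `F` over a family of independent choices with weights `w`. -/
def famSum (w : β → ℝ) (F : (V → β) → ℝ) : ℝ := ∑ c, (∏ v, w (c v)) * F c

/-- Resampling one coordinate does not change the expectation. -/
theorem famSum_resample (w : β → ℝ) (hw : ∑ x, w x = 1) (i : V) (F : (V → β) → ℝ) :
    famSum w F = famSum w fun c => ∑ x, w x * F (update c i x) := by
  have h1 : famSum w F = ∑ q : (V → β) × β, (∏ v, w (q.1 v)) * w q.2 * F q.1 := by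
    rw [Fintype.sum_prod_type]
    refine Finset.sum_congr rfl fun c _ => ?_
    simp only [mul_right_comm _ (w _) (F c)]
    rw [← Finset.mul_sum, hw, mul_one]
  have h2 : (famSum w fun c => ∑ x, w x * F (update c i x)) =
      ∑ q : (V → β) × β, (∏ v, w (q.1 v)) * w q.2 * F (update q.1 i q.2) := by
    rw [Fintype.sum_prod_type]
    refine Finset.sum_congr rfl fun c _ => ?_
    simp only [Finset.mul_sum, mul_assoc]
  rw [h1, h2]
  -- Swapping the fresh value with coordinate `i` is an involution that preserves the joint weight.
  refine Finset.sum_nbij' (fun q => (update q.1 i q.2, q.1 i)) (fun q => (update q.1 i q.2, q.1 i))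
    (by simp) (by simp) (by simp) (by simp) ?_
  rintro ⟨c, x⟩ -
  simp only [update_idem, update_eq_self, prod_update_mul]

theorem famSum_mono {w : β → ℝ} (hw : ∀ x, 0 ≤ w x) {F G : (V → β) → ℝ} (h : ∀ c, F c ≤ G c) :
    famSum w F ≤ famSum w G :=
  Finset.sum_le_sum fun c _ =>
    mul_le_mul_of_nonneg_left (h c) (Finset.prod_nonneg fun v _ => hw (c v))

theorem famSum_const_mul (w : β → ℝ) (a : ℝ) (F : (V → β) → ℝ) :
    (famSum w fun c => a * F c) = a * famSum w F := by
  simp only [famSum, Finset.mul_sum, mul_left_comm a]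

theorem famSum_add (w : β → ℝ) (F G : (V → β) → ℝ) :
    (famSum w fun c => F c + G c) = famSum w F + famSum w G := by
  simp only [famSum, mul_add, Finset.sum_add_distrib]

theorem famSum_sum {ι : Type} (w : β → ℝ) (S : Finset ι) (F : ι → (V → β) → ℝ) :
    (famSum w fun c => ∑ i ∈ S, F i c) = ∑ i ∈ S, famSum w (F i) := by
  simp only [famSum, Finset.mul_sum]
  exact Finset.sum_comm

theorem famSum_const {w : β → ℝ} (hw : ∑ x, w x = 1) (a : ℝ) :
    famSum (V := V) w (fun _ => a) = a := by
  rw [famSum, ← Finset.sum_mul, ← Fintype.piFinset_univ, ← Finset.prod_univ_sum]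
  simp [hw]

end ProductWeights

/-! ### Mean reciprocal cardinalities in one round. -/

section Round

variable {n : ℕ}

/-- The weight of the choice of one node: a uniform recipient and a coin of bias `s`. -/
noncomputable def nodeWeight (n : ℕ) (s : ℝ) (x : Fin n × Bool) : ℝ := (n : ℝ)⁻¹ * if x.2 then s else 1 - s

/-- The nodes that receive a message when the nodes of `S` send. -/
def recipients (c : Fin n → Fin n × Bool) (S : Finset (Fin n)) : Finset (Fin n) :=
  S.image fun i => (c i).1

theorem nodeWeight_nonneg {s : ℝ} (h0 : 0 ≤ s) (h1 : s ≤ 1) (x : Fin n × Bool) :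
    0 ≤ nodeWeight n s x := by
  have : 0 ≤ 1 - s := by linarith
  unfold nodeWeight
  split_ifs <;> positivity

theorem sum_nodeWeight_mul (s : ℝ) (f : Fin n → ℝ) :
    ∑ x, nodeWeight n s x * f x.1 = (n : ℝ)⁻¹ * ∑ j, f j := by
  rw [Fintype.sum_prod_type, Finset.mul_sum]
  refine Finset.sum_congr rfl fun j _ => ?_
  simp [nodeWeight]
  ring

theorem sum_nodeWeight_coin_mul (s : ℝ) (f : Fin n → ℝ) :
    ∑ x, nodeWeight n s x * ((if x.2 then 1 else 0) * f x.1) =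
      s * ∑ x, nodeWeight n s x * f x.1 := by
  rw [sum_nodeWeight_mul, Fintype.sum_prod_type, Finset.mul_sum, Finset.mul_sum]
  refine Finset.sum_congr rfl fun j _ => ?_
  simp [nodeWeight]
  ring

theorem sum_nodeWeight [NeZero n] (s : ℝ) : ∑ x, nodeWeight n s x = 1 := by
  have h := sum_nodeWeight_mul (n := n) s fun _ => 1
  simpa [NeZero.ne n] using h

theorem recipients_update_insert (c : Fin n → Fin n × Bool) {S : Finset (Fin n)} {i : Fin n}
    (hi : i ∉ S) (x : Fin n × Bool) :
    recipients (update c i x) (insert i S) = insert x.1 (recipients c S) := by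
  rw [recipients, Finset.image_insert, update_self]
  congr 1
  exact Finset.image_congr fun j hj => by
    rw [update_of_ne (ne_of_mem_of_not_mem hj hi)]

/-- A uniform node falls in `U` with probability `|U| / n`, and a collision raises the reciprocal by
`1 / ((|U| + j) (|U| + j + 1))`; the product is at most `1 / n` times the main term. -/
theorem sum_inv_card_insert_le [NeZero n] (U : Finset (Fin n)) (j : ℕ) :
    (n : ℝ)⁻¹ * ∑ x, (((insert x U).card : ℝ) + j)⁻¹ ≤
      (1 + (n : ℝ)⁻¹) * ((U.card : ℝ) + (j + 1 : ℕ))⁻¹ := by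
  have hn : (0 : ℝ) < n := by exact_mod_cast Nat.pos_of_ne_zero (NeZero.ne n)
  have hpt : ∀ x : Fin n, (((insert x U).card : ℝ) + j)⁻¹ =
      ((U.card : ℝ) + (j + 1 : ℕ))⁻¹ +
        if x ∈ U then ((U.card : ℝ) + j)⁻¹ - ((U.card : ℝ) + (j + 1 : ℕ))⁻¹ else 0 := by
    intro x
    by_cases hx : x ∈ U
    · simp [hx]
    · rw [Finset.card_insert_of_notMem hx, if_neg hx]
      push_cast
      ring
  have hgap : (U.card : ℝ) * (((U.card : ℝ) + j)⁻¹ - ((U.card : ℝ) + (j + 1 : ℕ))⁻¹) ≤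
      ((U.card : ℝ) + (j + 1 : ℕ))⁻¹ := by
    rcases Nat.eq_zero_or_pos U.card with h | h
    · rw [h]
      simp only [Nat.cast_zero, zero_mul]
      positivity
    · have hy : (0 : ℝ) < U.card := by exact_mod_cast h
      have e : (U.card : ℝ) * (((U.card : ℝ) + j)⁻¹ - ((U.card : ℝ) + (j + 1 : ℕ))⁻¹) =
          (U.card : ℝ) / (U.card + j) * ((U.card : ℝ) + (j + 1 : ℕ))⁻¹ := by
        push_cast
        field_simp
        ring
      rw [e]
      exact mul_le_of_le_one_left (by positivity)
        (div_le_one_of_le₀ (by linarith [Nat.cast_nonneg (α := ℝ) j]) (by positivity))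
  simp only [hpt, Finset.sum_add_distrib, Finset.sum_const, Finset.card_univ, Fintype.card_fin,
    nsmul_eq_mul, Finset.sum_ite_mem, Finset.univ_inter]
  rw [mul_add, ← mul_assoc, inv_mul_cancel₀ hn.ne', add_mul]
  gcongr

/-- The mean reciprocal of the number of distinct elements of `B` and of `S.card` uniform nodes. -/
theorem famSum_inv_card_recipients_le [NeZero n] {s : ℝ} (h0 : 0 ≤ s) (h1 : s ≤ 1)
    (B S : Finset (Fin n)) (j : ℕ) :
    famSum (nodeWeight n s) (fun c => (((recipients c S ∪ B).card : ℝ) + j)⁻¹) ≤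
      (1 + (n : ℝ)⁻¹) ^ S.card * ((B.card : ℝ) + S.card + j)⁻¹ := by
  -- The shift `j` counts the senders already averaged out: each trades its insertion for `+ 1` in
  -- the denominator.
  induction S using Finset.induction_on generalizing j with
  | empty => simp [recipients, famSum_const (sum_nodeWeight s)]
  | insert i S hi ih =>
    rw [famSum_resample _ (sum_nodeWeight s) i]
    simp only [recipients_update_insert _ hi, Finset.insert_union]
    refine (famSum_mono (nodeWeight_nonneg h0 h1) fun c => ?_).trans
      ((famSum_const_mul _ (1 + (n : ℝ)⁻¹)
        fun c => (((recipients c S ∪ B).card : ℝ) + (j + 1 : ℕ))⁻¹).trans_le ?_)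
    · rw [sum_nodeWeight_mul s fun x => (((insert x (recipients c S ∪ B)).card : ℝ) + j)⁻¹]
      exact sum_inv_card_insert_le _ j
    · refine (mul_le_mul_of_nonneg_left (ih (j + 1)) (by positivity)).trans_eq ?_
      rw [Finset.card_insert_of_notMem hi, pow_succ]
      push_cast
      ring

/-- The probability that no node of `S` sends to `v`. -/
theorem famSum_notMem_recipients [NeZero n] (s : ℝ) (v : Fin n) (S : Finset (Fin n)) :
    famSum (nodeWeight n s) (fun c => if v ∈ recipients c S then 0 else 1) =
      (1 - (n : ℝ)⁻¹) ^ S.card := by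
  have hn : (n : ℝ) ≠ 0 := by exact_mod_cast NeZero.ne n
  induction S using Finset.induction_on with
  | empty => simp [recipients, famSum_const (sum_nodeWeight s)]
  | insert i S hi ih =>
    rw [famSum_resample _ (sum_nodeWeight s) i, Finset.card_insert_of_notMem hi, pow_succ', ← ih,
      ← famSum_const_mul]
    congr 1
    funext c
    rw [Finset.sum_congr rfl fun x _ => by rw [recipients_update_insert _ hi],
      sum_nodeWeight_mul s fun x => if v ∈ insert x (recipients c S) then (0 : ℝ) else 1]
    by_cases hv : v ∈ recipients c S
    · simp [hv]
    · have : ∀ x : Fin n, (if v ∈ insert x (recipients c S) then (0 : ℝ) else 1) =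
          1 - if v = x then 1 else 0 := by
        intro x
        by_cases h : v = x <;> simp [hv, h]
      simp only [this, Finset.sum_sub_distrib, hv]
      simp [mul_sub, hn]

/-- The coin of `i` is independent of the recipients. -/
theorem famSum_coin_mul [NeZero n] (s : ℝ) (i : Fin n) (G : (Fin n → Fin n) → ℝ) :
    famSum (nodeWeight n s) (fun c => (if (c i).2 then 1 else 0) * G fun v => (c v).1) =
      s * famSum (nodeWeight n s) fun c => G fun v => (c v).1 := by
  rw [famSum_resample _ (sum_nodeWeight s) i,
    famSum_resample _ (sum_nodeWeight s) i fun c => G fun v => (c v).1, ← famSum_const_mul]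
  congr 1
  funext c
  have h : ∀ x : Fin n × Bool,
      (fun v => (update c i x v).1) = update (fun v => (c v).1) i x.1 := by
    intro x
    funext v
    by_cases hv : v = i
    · subst hv; simp
    · simp [hv]
  simp only [h, update_self]
  exact sum_nodeWeight_coin_mul s fun x => G (update (fun v => (c v).1) i x)

/-- The chord bound for `1 / x` on the interval from `Y.card` to `(Y ∪ S).card`. -/
theorem inv_card_union_le {Y S : Finset (Fin n)} (hY : Y.Nonempty) (P : Fin n → Prop)
    [DecidablePred P] :
    (((S.filter P) ∪ Y).card : ℝ)⁻¹ ≤ (Y.card : ℝ)⁻¹ -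
      ∑ i ∈ S, (if P i then 1 else 0) *
        if i ∈ Y then 0 else ((Y.card : ℝ) * (Y ∪ S).card)⁻¹ := by
  have hsum : ∑ i ∈ S, (if P i then 1 else 0) *
      (if i ∈ Y then 0 else ((Y.card : ℝ) * (Y ∪ S).card)⁻¹) =
      ((S.filter P) \ Y).card * ((Y.card : ℝ) * (Y ∪ S).card)⁻¹ := by
    rw [← nsmul_eq_mul (_ \ Y).card, ← Finset.sum_const, Finset.sdiff_eq_filter, Finset.filter_filter,
      Finset.sum_filter]
    refine Finset.sum_congr rfl fun i _ => ?_
    by_cases h1 : P i <;> by_cases h2 : i ∈ Y <;> simp [h1, h2]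
  have hcard : ((S.filter P) ∪ Y).card = ((S.filter P) \ Y).card + Y.card := by
    rw [← Finset.sdiff_union_self_eq_union, Finset.card_union_of_disjoint Finset.sdiff_disjoint]
  have hle : (((S.filter P) \ Y).card : ℝ) + Y.card ≤ (Y ∪ S).card := by
    rw [← Nat.cast_add, ← hcard, Finset.union_comm]
    exact_mod_cast Finset.card_le_card
      (Finset.union_subset_union_right (Finset.filter_subset _ _))
  have hy : (0 : ℝ) < Y.card := by exact_mod_cast hY.card_pos
  rw [hsum, hcard, Nat.cast_add]
  set k : ℝ := (((S.filter P) \ Y).card : ℝ)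
  have hk : 0 ≤ k := Nat.cast_nonneg _
  -- Exact for `k` kept nodes outside `Y`; enlarging `k + |Y|` to `|Y ∪ S|` makes the bound linear
  -- in the coins.
  have e : (k + (Y.card : ℝ))⁻¹ = (Y.card : ℝ)⁻¹ - k * ((Y.card : ℝ) * (k + Y.card))⁻¹ := by
    field_simp
    ring
  rw [e]
  gcongr

/-- The chord is exact at its far end, where all coins are kept; averaging coins of bias `s` thus
gives `s` times this drop. -/
theorem sum_notMem_mul_inv {Y S : Finset (Fin n)} (hY : Y.Nonempty) :
    ∑ i ∈ S, (if i ∈ Y then 0 else ((Y.card : ℝ) * (Y ∪ S).card)⁻¹) =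
      (Y.card : ℝ)⁻¹ - ((Y ∪ S).card : ℝ)⁻¹ := by
  have h1 : ∑ i ∈ S, (if i ∈ Y then 0 else ((Y.card : ℝ) * (Y ∪ S).card)⁻¹) =
      (S \ Y).card * ((Y.card : ℝ) * (Y ∪ S).card)⁻¹ := by
    rw [← nsmul_eq_mul (_ \ Y).card, ← Finset.sum_const, Finset.sdiff_eq_filter, Finset.sum_filter]
    exact Finset.sum_congr rfl fun i _ => by by_cases h : i ∈ Y <;> simp [h]
  have h2 : ((Y ∪ S).card : ℝ) = (S \ Y).card + Y.card := by
    rw [Finset.union_comm, ← Finset.sdiff_union_self_eq_union,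
      Finset.card_union_of_disjoint Finset.sdiff_disjoint, Nat.cast_add]
  have hy : (0 : ℝ) < Y.card := by exact_mod_cast hY.card_pos
  have hk : (0 : ℝ) ≤ (S \ Y).card := Nat.cast_nonneg _
  rw [h1, h2]
  field_simp
  ring

/-- The mean reciprocal of the number of active nodes decreases by the factor `1 - s / 2` in one
round, up to collisions. -/
theorem famSum_inv_card_active_le [NeZero n] {s : ℝ} (h0 : 0 ≤ s) (h1 : s ≤ 1)
    {S : Finset (Fin n)} (hS : S.Nonempty) :
    famSum (nodeWeight n s)
        (fun c => (((S.filter fun i => (c i).2 = true) ∪ recipients c S).card : ℝ)⁻¹) ≤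
      (1 + (n : ℝ)⁻¹) ^ S.card * (1 - s / 2) * (S.card : ℝ)⁻¹ := by
  have hne : ∀ c : Fin n → Fin n × Bool, (recipients c S).Nonempty := fun c => hS.image _
  -- The chord coefficient of `i` depends on the recipients alone, so its coin factors out.
  let G : Fin n → (Fin n → Fin n) → ℝ := fun i t =>
    if i ∈ S.image t then 0 else (((S.image t).card : ℝ) * (S.image t ∪ S).card)⁻¹
  have key : famSum (nodeWeight n s)
      (fun c => ∑ i ∈ S, (if (c i).2 = true then 1 else 0) * G i fun v => (c v).1) =
      s * famSum (nodeWeight n s) (fun c =>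
        ((recipients c S).card : ℝ)⁻¹ + (-1) * ((recipients c S ∪ S).card : ℝ)⁻¹) := by
    rw [famSum_sum]
    simp only [famSum_coin_mul]
    rw [← Finset.mul_sum, ← famSum_sum]
    congr 2
    funext c
    exact (sum_notMem_mul_inv (hne c)).trans (by ring)
  have hb1 := famSum_inv_card_recipients_le h0 h1 ∅ S 0
  have hb2 := famSum_inv_card_recipients_le h0 h1 S S 0
  simp only [Finset.union_empty, Nat.cast_zero, add_zero, Finset.card_empty, zero_add] at hb1 hb2
  -- Starting from `B = S` doubles the denominator: the source of `s / 2`.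
  rw [← two_mul, mul_inv] at hb2
  have hchord := famSum_mono (nodeWeight_nonneg (n := n) h0 h1)
    (G := fun c => ((recipients c S).card : ℝ)⁻¹ +
      (-1) * ∑ i ∈ S, (if (c i).2 = true then 1 else 0) * G i fun v => (c v).1)
    fun c => (inv_card_union_le (S := S) (hne c) fun i => (c i).2 = true).trans_eq
      (by rw [neg_one_mul, ← sub_eq_add_neg]; rfl)
  refine hchord.trans ?_
  rw [famSum_add, famSum_const_mul, key, famSum_add, famSum_const_mul]
  have := mul_le_mul_of_nonneg_left hb1 (sub_nonneg.2 h1)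
  have := mul_le_mul_of_nonneg_left hb2 h0
  linarith

end Round

/-! ### Expectations, Markov's inequality and the drift of the potentials. -/

section Expectation

open scoped ENNReal

/-- The expectation of a nonnegative function. -/
noncomputable def expect {α : Type} (p : PMF α) (f : α → ℝ≥0∞) : ℝ≥0∞ := ∑' x, p x * f x

theorem expect_pure {α : Type} (a : α) (f : α → ℝ≥0∞) : expect (PMF.pure a) f = f a := by
  rw [expect, tsum_eq_single a]
  · simp
  · intro b hb
    simp [PMF.pure_apply, hb]

theorem expect_bind {α β : Type} (p : PMF α) (q : α → PMF β) (f : β → ℝ≥0∞) :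
    expect (p.bind q) f = expect p fun x => expect (q x) f := by
  simp only [expect, PMF.bind_apply, ← ENNReal.tsum_mul_right, ← ENNReal.tsum_mul_left]
  rw [ENNReal.tsum_comm]
  simp only [mul_assoc]

theorem expect_map {α β : Type} (p : PMF α) (g : α → β) (f : β → ℝ≥0∞) :
    expect (p.map g) f = expect p fun x => f (g x) := by
  rw [← PMF.bind_pure_comp, expect_bind]
  simp only [Function.comp_apply, expect_pure]

theorem expect_mono {α : Type} (p : PMF α) {f g : α → ℝ≥0∞} (h : ∀ x, f x ≤ g x) :
    expect p f ≤ expect p g :=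
  ENNReal.tsum_le_tsum fun x => mul_le_mul_right (h x) _

theorem expect_const_mul {α : Type} (p : PMF α) (a : ℝ≥0∞) (f : α → ℝ≥0∞) :
    (expect p fun x => a * f x) = a * expect p f := by
  simp only [expect, ← ENNReal.tsum_mul_left, mul_left_comm a]

theorem mul_toOuterMeasure_le_expect {α : Type} (p : PMF α) (f : α → ℝ≥0∞) (a : ℝ≥0∞) (E : Set α)
    (h : ∀ x ∈ E, a ≤ f x) : a * p.toOuterMeasure E ≤ expect p f := by
  rw [PMF.toOuterMeasure_apply, ← ENNReal.tsum_mul_left]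
  refine ENNReal.tsum_le_tsum fun x => ?_
  by_cases hx : x ∈ E
  · rw [Set.indicator_of_mem hx, mul_comm]
    exact mul_le_mul_right (h x hx) _
  · simp [hx]

/-- Markov's inequality with an exponential bound. -/
theorem toOuterMeasure_le_of_expect_le {α : Type} (p : PMF α) (f : α → ℝ≥0∞) (E : Set α)
    {a b : ℝ} (h : ∀ x ∈ E, ENNReal.ofReal (Real.exp a) ≤ f x)
    (hf : expect p f ≤ ENNReal.ofReal (Real.exp b)) :
    p.toOuterMeasure E ≤ ENNReal.ofReal (Real.exp (b - a)) := by
  rw [Real.exp_sub, ENNReal.ofReal_div_of_pos (Real.exp_pos a)]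
  rw [ENNReal.le_div_iff_mul_le (by simp [Real.exp_pos]) (by simp), mul_comm]
  exact (mul_toOuterMeasure_le_expect p f _ E h).trans hf

theorem one_sub_le_prob {α : Type} (p : PMF α) (E : Set α) {δ : ℝ} (hδ : 0 ≤ δ)
    (h : p.toOuterMeasure Eᶜ ≤ ENNReal.ofReal δ) : 1 - δ ≤ prob p E := by
  have hu : p.toOuterMeasure Set.univ = 1 :=
    (PMF.toOuterMeasure_apply_eq_one_iff p Set.univ).2 (Set.subset_univ _)
  have hfin : p.toOuterMeasure E ≠ ∞ :=
    ne_top_of_le_ne_top ENNReal.one_ne_top (hu ▸ MeasureTheory.measure_mono (Set.subset_univ E))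
  have h1 : (1 : ℝ≥0∞) ≤ p.toOuterMeasure E + ENNReal.ofReal δ := by
    rw [← hu, ← Set.union_compl_self E]
    exact (MeasureTheory.measure_union_le _ _).trans (add_le_add_right h _)
  have h2 := ENNReal.toReal_mono (ENNReal.add_ne_top.2 ⟨hfin, ENNReal.ofReal_ne_top⟩) h1
  rw [ENNReal.toReal_one, ENNReal.toReal_add hfin ENNReal.ofReal_ne_top,
    ENNReal.toReal_ofReal hδ] at h2
  unfold prob
  linarith

variable {n : ℕ}

/-- The potential that measures a lack of messages. -/
noncomputable def sentPotential (σ : State n) : ℝ≥0∞ :=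
  (σ.active.card : ℝ≥0∞)⁻¹ * ENNReal.ofReal (Real.exp (-(σ.sent / n)))

/-- The potential that measures the number of messages sent while `v` is not informed. -/
noncomputable def missPotential (v : Fin n) (σ : State n) : ℝ≥0∞ :=
  if v ∈ σ.informed then 0 else ENNReal.ofReal (Real.exp (σ.sent / n))

theorem sentPotential_eq {σ : State n} (h : σ.active.Nonempty) :
    sentPotential σ =
      ENNReal.ofReal ((σ.active.card : ℝ)⁻¹ * Real.exp (-(σ.sent / n))) := by
  have : (0 : ℝ) < σ.active.card := by exact_mod_cast h.card_pos
  rw [sentPotential, ENNReal.ofReal_mul (by positivity), ENNReal.ofReal_inv_of_pos this,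
    ENNReal.ofReal_natCast]

variable [NeZero n]

theorem nodeChoice_apply (s : unitInterval) (x : Fin n × Bool) :
    nodeChoice n s x = ENNReal.ofReal (nodeWeight n s x) := by
  obtain ⟨j, b⟩ := x
  have hmap : ∀ i : Fin n, ((keepCoin s).map fun b => (i, b)) (j, b) =
      if i = j then keepCoin s b else 0 := by
    intro i
    rw [PMF.map_apply, tsum_eq_single b]
    · by_cases h : i = j <;> simp [h, Ne.symm]
    · intro b' hb'
      rw [if_neg]
      simp [hb'.symm]
  rw [nodeChoice, PMF.bind_apply, tsum_eq_single j]
  · rw [hmap, if_pos rfl, PMF.uniformOfFintype_apply, Fintype.card_fin, nodeWeight,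
      ENNReal.ofReal_mul (by positivity), ENNReal.ofReal_inv_of_pos
        (by exact_mod_cast Nat.pos_of_ne_zero (NeZero.ne n)), ENNReal.ofReal_natCast]
    rfl
  · intro i hi
    rw [hmap, if_neg hi, mul_zero]

theorem expect_iidFamily (s : unitInterval) (F : (Fin n → Fin n × Bool) → ℝ)
    (hF : ∀ c, 0 ≤ F c) :
    (expect (iidFamily (Fin n) (nodeChoice n s)) fun c => ENNReal.ofReal (F c)) =
      ENNReal.ofReal (famSum (nodeWeight n s) F) := by
  have hw := nodeWeight_nonneg (n := n) s.2.1 s.2.2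
  rw [expect, tsum_fintype, famSum, ENNReal.ofReal_sum_of_nonneg
    fun c _ => mul_nonneg (Finset.prod_nonneg fun v _ => hw _) (hF c)]
  refine Finset.sum_congr rfl fun c _ => ?_
  rw [ENNReal.ofReal_mul (Finset.prod_nonneg fun v _ => hw _),
    ENNReal.ofReal_prod_of_nonneg fun v _ => hw _]
  congr 1
  rw [iidFamily, PMF.ofFintype_apply]
  exact Finset.prod_congr rfl fun v _ => nodeChoice_apply s (c v)

/-- A function that contracts in one round contracts geometrically along the run. -/
theorem expect_run_le (s : unitInterval) (k : Fin n) (Φ : State n → ℝ≥0∞) (r : ℝ≥0∞)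
    (h : ∀ σ, (expect (iidFamily (Fin n) (nodeChoice n s)) fun c => Φ (roundStep c σ)) ≤ r * Φ σ)
    (R : ℕ) : expect (run n s k R) Φ ≤ r ^ R * Φ (initial k) := by
  induction R with
  | zero => simp [run, expect_pure]
  | succ R ih =>
    rw [run, expect_bind]
    simp only [expect_map]
    refine (expect_mono _ h).trans ?_
    rw [expect_const_mul, pow_succ', mul_assoc]
    exact mul_le_mul_right ih r

theorem expect_sentPotential_roundStep_le (s : unitInterval) (σ : State n) :
    (expect (iidFamily (Fin n) (nodeChoice n s)) fun c => sentPotential (roundStep c σ)) ≤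
      ENNReal.ofReal (1 - (s : ℝ) / 2) * sentPotential σ := by
  have hs : 0 < 1 - (s : ℝ) / 2 := by linarith [s.2.2]
  rcases σ.active.eq_empty_or_nonempty with h | h
  -- With no active node the potential is `∞`, and the nonzero factor keeps the right side infinite.
  · refine le_top.trans_eq (Eq.symm ?_)
    have : sentPotential σ = ∞ := by
      rw [sentPotential, h]
      simp [ENNReal.top_mul, Real.exp_pos]
    rw [this, ENNReal.mul_top]
    simpa using hs
  · have hne : ∀ c, (roundStep c σ).active.Nonempty := fun c =>
      (h.image fun i => (c i).1).mono Finset.subset_union_right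
    simp only [sentPotential_eq (hne _)]
    rw [expect_iidFamily s _ fun c => by positivity, sentPotential_eq h,
      ← ENNReal.ofReal_mul hs.le]
    refine ENNReal.ofReal_le_ofReal ?_
    have hstep := famSum_inv_card_active_le (n := n) s.2.1 s.2.2 h
    have hexp : (1 + (n : ℝ)⁻¹) ^ σ.active.card * Real.exp (-(((σ.sent + σ.active.card : ℕ) : ℝ) / n))
        ≤ Real.exp (-(σ.sent / n)) := by
      have h1 : (1 + (n : ℝ)⁻¹) ^ σ.active.card ≤ Real.exp (σ.active.card / n) := by
        rw [div_eq_mul_inv, Real.exp_nat_mul]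
        gcongr
        linarith [Real.add_one_le_exp ((n : ℝ)⁻¹)]
      refine (mul_le_mul_of_nonneg_right h1 (Real.exp_pos _).le).trans_eq ?_
      rw [← Real.exp_add]
      congr 1
      push_cast
      ring
    calc famSum (nodeWeight n s) (fun c => ((roundStep c σ).active.card : ℝ)⁻¹ *
          Real.exp (-((roundStep c σ).sent / n)))
        = Real.exp (-(((σ.sent + σ.active.card : ℕ) : ℝ) / n)) * famSum (nodeWeight n s) (fun c =>
          (((σ.active.filter fun i => (c i).2 = true) ∪ recipients c σ.active).card : ℝ)⁻¹) := by
          rw [← famSum_const_mul]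
          congr 1
          funext c
          exact mul_comm _ _
      _ ≤ Real.exp (-(((σ.sent + σ.active.card : ℕ) : ℝ) / n)) *
          ((1 + (n : ℝ)⁻¹) ^ σ.active.card * (1 - s / 2) * (σ.active.card : ℝ)⁻¹) := by
          gcongr
      _ = (1 - s / 2) * ((σ.active.card : ℝ)⁻¹ * ((1 + (n : ℝ)⁻¹) ^ σ.active.card *
          Real.exp (-(((σ.sent + σ.active.card : ℕ) : ℝ) / n)))) := by ring
      _ ≤ _ := by gcongr

/-- The chance `(1 - 1 / n) ^ |A| ≤ exp (-|A| / n)` of missing `v` offsets the growth of the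
exponential. -/
theorem expect_missPotential_roundStep_le (s : unitInterval) (v : Fin n) (σ : State n) :
    (expect (iidFamily (Fin n) (nodeChoice n s)) fun c => missPotential v (roundStep c σ)) ≤
      1 * missPotential v σ := by
  rw [one_mul]
  by_cases hv : v ∈ σ.informed
  · have : ∀ c, v ∈ (roundStep c σ).informed := fun c => Finset.mem_union_left _ hv
    simp [missPotential, this, expect]
  · have hpt : ∀ c, missPotential v (roundStep c σ) =
        ENNReal.ofReal (Real.exp (((σ.sent + σ.active.card : ℕ) : ℝ) / n) *
          if v ∈ recipients c σ.active then 0 else 1) := by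
      intro c
      have : v ∈ (roundStep c σ).informed ↔ v ∈ recipients c σ.active := by
        simp [roundStep, recipients, hv]
      simp only [missPotential, this]
      by_cases h : v ∈ recipients c σ.active <;> simp [h, roundStep]
    simp only [hpt]
    rw [expect_iidFamily s _ fun c => by positivity, famSum_const_mul, famSum_notMem_recipients,
      missPotential, if_neg hv]
    refine ENNReal.ofReal_le_ofReal ?_
    have hn : (1 : ℝ) ≤ n := by exact_mod_cast Nat.one_le_iff_ne_zero.2 (NeZero.ne n)
    have h1 : (1 - (n : ℝ)⁻¹) ^ σ.active.card ≤ Real.exp (-(σ.active.card / n)) := by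
      rw [div_eq_mul_inv, ← mul_neg, Real.exp_nat_mul]
      gcongr
      · exact sub_nonneg.2 (inv_le_one_of_one_le₀ hn)
      · linarith [Real.add_one_le_exp (-(n : ℝ)⁻¹)]
    refine (mul_le_mul_of_nonneg_left h1 (Real.exp_pos _).le).trans_eq ?_
    rw [← Real.exp_add]
    congr 1
    push_cast
    ring

end Expectation

/-! ### Tail bounds and the union bound. -/

section SpreadingTime

variable {n : ℕ} [NeZero n]

theorem toOuterMeasure_sent_lt_le (s : unitInterval) (hs : 0 < (s : ℝ)) {C : ℝ} (hC : 1 ≤ C)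
    (k : Fin n) :
    (run n s k ⌊6 * C * Real.log n / (s : ℝ)⌋₊).toOuterMeasure
      {σ | (σ.sent : ℝ) < C * n * Real.log n} ≤ ENNReal.ofReal (Real.exp (1 - Real.log n)) := by
  have hn1 : (1 : ℝ) ≤ n := by exact_mod_cast Nat.one_le_iff_ne_zero.2 (NeZero.ne n)
  have hn : (0 : ℝ) < n := by linarith
  have hL : 0 ≤ Real.log n := Real.log_nonneg hn1
  set L := Real.log n
  set T := ⌊6 * C * L / (s : ℝ)⌋₊
  have hexpect : expect (run n s k T) sentPotential ≤ ENNReal.ofReal (Real.exp (1 - 3 * C * L)) := by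
    refine (expect_run_le s k sentPotential _ (expect_sentPotential_roundStep_le s) T).trans ?_
    have hinit : sentPotential (initial k) = 1 := by simp [sentPotential, initial]
    have h2 : 0 ≤ 1 - (s : ℝ) / 2 := by linarith [s.2.2]
    rw [hinit, mul_one, ← ENNReal.ofReal_pow h2]
    refine ENNReal.ofReal_le_ofReal ?_
    -- The floor loses less than one round, hence at most `s / 2 ≤ 1` in the exponent.
    have hT : 6 * C * L < (T + 1) * s := (div_lt_iff₀ hs).1 (Nat.lt_floor_add_one _)
    calc (1 - (s : ℝ) / 2) ^ T ≤ Real.exp (-(s / 2)) ^ T := by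
          gcongr
          linarith [Real.add_one_le_exp (-((s : ℝ) / 2))]
      _ = Real.exp (T * -(s / 2)) := (Real.exp_nat_mul _ _).symm
      _ ≤ Real.exp (1 - 3 * C * L) := by
          gcongr
          linarith [s.2.2]
  have hpt : ∀ σ ∈ {σ : State n | (σ.sent : ℝ) < C * n * L},
      ENNReal.ofReal (Real.exp (-L - C * L)) ≤ sentPotential σ := by
    intro σ hσ
    have hsent : (σ.sent : ℝ) / n ≤ C * L := by
      rw [div_le_iff₀ hn]
      exact (le_of_lt hσ).trans_eq (by ring)
    rw [sentPotential, sub_eq_add_neg, Real.exp_add, ENNReal.ofReal_mul (Real.exp_pos _).le]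
    refine mul_le_mul' ?_ (ENNReal.ofReal_le_ofReal (Real.exp_le_exp.2 (neg_le_neg hsent)))
    rw [Real.exp_neg, Real.exp_log hn, ENNReal.ofReal_inv_of_pos hn, ENNReal.ofReal_natCast]
    refine ENNReal.inv_le_inv.2 ?_
    exact_mod_cast (Finset.card_le_univ σ.active).trans_eq (Fintype.card_fin n)
  refine (toOuterMeasure_le_of_expect_le _ _ _ hpt hexpect).trans
    (ENNReal.ofReal_le_ofReal (Real.exp_le_exp.2 ?_))
  -- The exponent is `1 - (2 * C - 1) * L`, and `C ≥ 1`, `L ≥ 0`.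
  nlinarith

theorem toOuterMeasure_uninformed_le (s : unitInterval) (k v : Fin n) (R : ℕ) (a : ℝ) :
    (run n s k R).toOuterMeasure {σ | v ∉ σ.informed ∧ a * n ≤ (σ.sent : ℝ)} ≤
      ENNReal.ofReal (Real.exp (-a)) := by
  have hn : (0 : ℝ) < n := by exact_mod_cast Nat.pos_of_ne_zero (NeZero.ne n)
  rw [← zero_sub]
  refine toOuterMeasure_le_of_expect_le _ (missPotential v) _ (fun σ hσ => ?_)
    ((expect_run_le s k _ 1 (expect_missPotential_roundStep_le s v) R).trans ?_)
  · rw [missPotential, if_neg hσ.1]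
    exact ENNReal.ofReal_le_ofReal (Real.exp_le_exp.2 ((le_div_iff₀ hn).2 hσ.2))
  · rw [one_pow, one_mul, missPotential]
    split_ifs
    · exact zero_le
    · simp [initial]

theorem toOuterMeasure_not_all_informed_le (s : unitInterval) (hs : 0 < (s : ℝ)) (k : Fin n) :
    (run n s k ⌊12 * Real.log n / (s : ℝ)⌋₊).toOuterMeasure {σ | σ.informed = Finset.univ}ᶜ ≤
      ENNReal.ofReal (4 / n) := by
  have hn : (0 : ℝ) < n := by exact_mod_cast Nat.pos_of_ne_zero (NeZero.ne n)
  set L := Real.log n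
  have h1 := toOuterMeasure_sent_lt_le s hs (C := 2) (by norm_num) k
  rw [show (6 : ℝ) * 2 = 12 by norm_num] at h1
  set p := run n s k ⌊12 * L / (s : ℝ)⌋₊
  have hsub : {σ : State n | σ.informed = Finset.univ}ᶜ ⊆
      {σ | (σ.sent : ℝ) < 2 * n * L} ∪
        ⋃ v : Fin n, {σ | v ∉ σ.informed ∧ 2 * L * n ≤ (σ.sent : ℝ)} := by
    intro σ hσ
    obtain ⟨v, hv⟩ : ∃ v, v ∉ σ.informed := by
      by_contra! hall
      exact hσ (Finset.eq_univ_iff_forall.2 hall)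
    rcases lt_or_ge (σ.sent : ℝ) (2 * n * L) with h | h
    · exact Or.inl h
    · exact Or.inr (Set.mem_iUnion.2 ⟨v, hv, by linarith⟩)
  have h2 : p.toOuterMeasure (⋃ v : Fin n, {σ | v ∉ σ.informed ∧ 2 * L * n ≤ (σ.sent : ℝ)}) ≤
      ENNReal.ofReal (1 / n) := by
    refine (MeasureTheory.measure_iUnion_fintype_le _ _).trans ?_
    refine (Finset.sum_le_sum fun v _ => toOuterMeasure_uninformed_le s k v _ (2 * L)).trans_eq ?_
    rw [Finset.sum_const, Finset.card_univ, Fintype.card_fin, nsmul_eq_mul,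
      ← ENNReal.ofReal_natCast n, ← ENNReal.ofReal_mul hn.le]
    congr 1
    rw [Real.exp_neg, two_mul, Real.exp_add, Real.exp_log hn]
    field_simp
  have h3 : Real.exp (1 - L) ≤ 3 / n := by
    rw [Real.exp_sub, Real.exp_log hn]
    gcongr
    exact Real.exp_one_lt_three.le
  calc p.toOuterMeasure {σ | σ.informed = Finset.univ}ᶜ
      ≤ ENNReal.ofReal (3 / n) + ENNReal.ofReal (1 / n) :=
        (MeasureTheory.measure_mono hsub).trans ((MeasureTheory.measure_union_le _ _).trans
          (add_le_add (h1.trans (ENNReal.ofReal_le_ofReal h3)) h2))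
    _ = ENNReal.ofReal (4 / n) := by
        rw [← ENNReal.ofReal_add (by positivity) (by positivity)]
        congr 1
        ring

theorem four_div_le_of_ceil_le {δ : ℝ} (hδ : 0 < δ) (h : ⌈4 / δ⌉₊ ≤ n) : 4 / (n : ℝ) ≤ δ := by
  have hn : (0 : ℝ) < n := by exact_mod_cast Nat.pos_of_ne_zero (NeZero.ne n)
  rw [div_le_iff₀ hn, mul_comm]
  exact (div_le_iff₀ hδ).1 (Nat.ceil_le.1 h)

end SpreadingTime

end Gossip

theorem mainTheorem5 :
    (∀ s : unitInterval, 0 < (s : ℝ) → ∀ δ : ℝ, 0 < δ → δ < 1 → ∀ C : ℝ, 1 ≤ C →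
      ∃ N : ℕ, ∀ (n : ℕ) [NeZero n], N ≤ n → ∀ k : Fin n,
        1 - δ ≤ Gossip.prob (Gossip.run n s k ⌊6 * C * Real.log n / (s : ℝ)⌋₊)
          {σ | C * n * Real.log n ≤ (σ.sent : ℝ)}) ∧
    (∃ K : ℝ, ∀ s : unitInterval, 0 < (s : ℝ) → ∀ δ : ℝ, 0 < δ → δ < 1 →
      ∃ N : ℕ, ∀ (n : ℕ) [NeZero n], N ≤ n → ∀ k : Fin n,
        1 - δ ≤ Gossip.prob (Gossip.run n s k ⌊K * Real.log n / (s : ℝ)⌋₊)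
          {σ | σ.informed = Finset.univ}) := by
  constructor
  · intro s hs δ hδ _ C hC
    refine ⟨⌈4 / δ⌉₊, fun n _ hN k => Gossip.one_sub_le_prob _ _ hδ.le ?_⟩
    have hn : (0 : ℝ) < n := by exact_mod_cast Nat.pos_of_ne_zero (NeZero.ne n)
    have hset : {σ : Gossip.State n | C * n * Real.log n ≤ (σ.sent : ℝ)}ᶜ =
        {σ | (σ.sent : ℝ) < C * n * Real.log n} := by
      ext σ
      simp
    rw [hset]
    refine (Gossip.toOuterMeasure_sent_lt_le s hs hC k).trans (ENNReal.ofReal_le_ofReal ?_)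
    refine le_trans ?_ (Gossip.four_div_le_of_ceil_le hδ hN)
    rw [Real.exp_sub, Real.exp_log hn]
    gcongr
    linarith [Real.exp_one_lt_three]
  -- `12 = 6 * 2`: taking `C = 2` leaves a failure probability `n⁻²` per node, enough for the union
  -- bound.
  · refine ⟨12, fun s hs δ hδ _ => ⟨⌈4 / δ⌉₊, fun n _ hN k =>
      Gossip.one_sub_le_prob _ _ hδ.le ?_⟩⟩
    exact (Gossip.toOuterMeasure_not_all_informed_le s hs k).trans
      (ENNReal.ofReal_le_ofReal (Gossip.four_div_le_of_ceil_le hδ hN))
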